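/- Let $\sigma, c, B > 0$ and $0 < \Delta \le B$. Let $\mathcal{M}_\Delta$ be the set of two-armed bandit models $\nu = (\nu_1, \nu_2)$ such that, for $a = 1, 2$, the distribution $\nu_a$ on $\mathbb{R}$ has a mean $\mu_a = \mathbb{E}_{\nu_a}[X] \in [0, B]$ and is $\sigma$-sub-Gaussian, i.e. $\mathbb{P}_{\nu_a}(X - \mu_a > t) \le \exp(-t^2/(2\sigma^2))$ for all $t > 0$, and such that $|\mu_1 - \mu_2| = \Delta$ (either arm may be the better one). A policy $\pi$ decides at each time, possibly at random and on the basis of the arms pulled and the rewards observed so far, either to pull one of the two arms, in which case it observes an independent sample from the distribution of that arm, or to stop and to recommend an arm $\hat I \in \{1, 2\}$; it may stop without pulling. Let $\tau$ be the total number of samples it collects ($\tau = \infty$ if it never stops), and let $$\mathcal{R}_1(\pi, \nu) = \mathbb{P}_{\nu,\pi}\bigl(\tau < \infty,\ \mu_{\hat I} \neq \max\{\mu_1, \mu_2\}\bigr) + c\, \mathbb{E}_{\nu,\pi}[\tau] \in [0, \infty].$$ Then, for every policy $\pi$, $$\sup_{\nu \in \mathcal{M}_\Delta} \mathcal{R}_1(\pi,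 \nu) \;\ge\; \begin{cases} \dfrac{\sigma^2 c}{4\Delta^2} \log\left(\dfrac{e\Delta^2}{\sigma^2 c}\right) & \text{if } \Delta \ge \sqrt{\sigma^2 c},\\[2mm] \dfrac14 & \text{if } \Delta < \sqrt{\sigma^2 c}. \end{cases}$$ -/

import Mathlib

open MeasureTheory ProbabilityTheory
open scoped ENNReal

noncomputable section

namespace CostBAI

/-! ### Two-armed bandit models -/

/-- The two arms. -/
abbrev Arm : Type := Fin 2

/-- A two-armed bandit model: one reward distribution on `ℝ` per arm. -/
abbrev Model : Type := Arm → ProbabilityMeasure ℝ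

/-- The mean reward of arm `a`. -/
def mean (ν : Model) (a : Arm) : ℝ := ∫ x, x ∂(ν a : Measure ℝ)

/-- The largest mean reward. -/
def bestMean (ν : Model) : ℝ := max (mean ν 0) (mean ν 1)

/-- `σ`-sub-Gaussian distributions: the mean exists and
`P(X - E[X] > t) ≤ exp(-t² / (2σ²))` for all `t > 0`. -/
def IsSubGaussian (σ : ℝ) (P : ProbabilityMeasure ℝ) : Prop :=
  Integrable (fun x : ℝ => x) (P : Measure ℝ) ∧
    ∀ t : ℝ, 0 < t →
      (P : Measure ℝ).real {x | t < x - ∫ y, y ∂(P : Measure ℝ)} ≤ Real.exp (-t ^ 2 / (2 * σ ^ 2))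

/-- Two-armed bandit models with `σ`-sub-Gaussian rewards and means in `[0, B]`. -/
def modelClass (σ B : ℝ) : Set Model :=
  {ν | ∀ a : Arm, IsSubGaussian σ (ν a) ∧ mean ν a ∈ Set.Icc 0 B}

/-- The models of the class whose two means differ by exactly `Δ`. Either arm may be the better
one: a policy does not know the order of the arms. -/
def gapClass (σ B Δ : ℝ) : Set Model :=
  {ν | ν ∈ modelClass σ B ∧ |mean ν 0 - mean ν 1| = Δ}

/-! ### Policies and their interaction with a model -/

/-- What a policy does at a given time: `inl a` is "pull arm `a`", `inr i` is "stop and recommend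
arm `i`". -/
abbrev Decision : Type := Arm ⊕ Arm

/-- A (randomised) policy: for each number `n` of samples collected so far, a Markov kernel from
the history `(A₁, X₁), …, (Aₙ, Xₙ)` of pulled arms and observed rewards to decisions. For `n = 0`
the history is empty, so that a policy may stop without pulling. -/
structure Policy where
  /-- The law of the next decision given the history. -/
  rule : (n : ℕ) → Kernel (Fin n → Arm × ℝ) Decision
  /-- The law of the next decision is a probability measure. -/
  isMarkov : ∀ n, IsMarkovKernel (rule n)

/-- What happens in a round: `inl (a, x)` is "arm `a` is pulled and gives reward `x`", `inr i` is
"the policy has stopped, with recommendation `i`" (a state that is never left). -/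
abbrev Record : Type := (Arm × ℝ) ⊕ Arm

/-- The law of the record of a round, given the decision taken: a pull of `a` gives a fresh sample
from `ν a`. -/
def outcome (ν : Model) : Kernel Decision Record where
  toFun := Sum.elim (fun a => (ν a : Measure ℝ).map fun x => Sum.inl (a, x))
    (fun i => Measure.dirac (Sum.inr i))
  measurable' := (measurable_of_countable _).sumElim (measurable_of_countable _)

instance (ν : Model) : IsMarkovKernel (outcome ν) := by
  refine ⟨fun d => ?_⟩
  rcases d with a | i
  · exact Measure.isProbabilityMeasure_map (μ := (ν a : Measure ℝ))
      (measurable_inl.comp measurable_prodMk_left).aemeasurable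
  · exact Measure.dirac.isProbabilityMeasure (x := (Sum.inr i : Record))

/-- The arm and the reward of a pull record (with an irrelevant value on a stop record). -/
def Record.pull (r : Record) : Arm × ℝ := Sum.elim id (fun _ => (0, 0)) r

theorem Record.measurable_pull : Measurable Record.pull :=
  measurable_id.sumElim measurable_const

/-- The history of pulls contained in the records of the rounds `0, …, n`. -/
def pulls (n : ℕ) (h : (i : Finset.Iic n) → Record) : Fin (n + 1) → Arm × ℝ :=
  fun i => (h ⟨i, Finset.mem_Iic.2 (Nat.le_of_lt_succ i.2)⟩).pull

theorem measurable_pulls (n : ℕ) : Measurable (pulls n) :=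
  measurable_pi_lambda _ fun _ => Record.measurable_pull.comp (measurable_pi_apply _)

/-- The record of round `n`. -/
def last (n : ℕ) (h : (i : Finset.Iic n) → Record) : Record := h ⟨n, Finset.mem_Iic.2 le_rfl⟩

theorem measurable_last (n : ℕ) : Measurable (last n) := measurable_pi_apply _

/-- The histories of the rounds `0, …, n` at the end of which the policy has stopped. -/
def stopped (n : ℕ) : Set ((i : Finset.Iic n) → Record) := last n ⁻¹' Set.range Sum.inr

theorem measurableSet_stopped (n : ℕ) : MeasurableSet (stopped n) :=
  measurable_last n measurableSet_range_inr

open Classical in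
/-- The law of the record of round `n + 1` given the records of the rounds `0, …, n`: if the policy
has stopped, nothing changes any more; otherwise it decides on the basis of the history of pulls,
and the decision is carried out. -/
def step (π : Policy) (ν : Model) (n : ℕ) : Kernel ((i : Finset.Iic n) → Record) Record :=
  Kernel.piecewise (measurableSet_stopped n)
    (Kernel.deterministic (last n) (measurable_last n))
    (outcome ν ∘ₖ (π.rule (n + 1)).comap (pulls n) (measurable_pulls n))

instance (π : Policy) (ν : Model) (n : ℕ) : IsMarkovKernel (step π ν n) := by
  have := π.isMarkov (n + 1)
  unfold step
  infer_instance

/-- The law of the record of round `0`, in which the policy decides on the empty history. -/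
def firstRecord (π : Policy) (ν : Model) : Measure Record :=
  (π.rule 0 Fin.elim0).bind (outcome ν)

/-- The law of the sequence of records when the policy `π` interacts with the model `ν`. -/
def interaction (π : Policy) (ν : Model) : Measure (ℕ → Record) :=
  Kernel.trajMeasure (X := fun _ => Record) (firstRecord π ν) (step π ν)

instance (π : Policy) (ν : Model) : IsProbabilityMeasure (interaction π ν) := by
  have := π.isMarkov 0
  have : IsProbabilityMeasure (firstRecord π ν) := by
    unfold firstRecord
    infer_instance
  unfold interaction
  infer_instance

/-! ### The risk -/

/-- The stopping time, that is, the total number of samples: the first round (counted from `0`) in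
which the policy stops instead of pulling, and `⊤` if it never stops. -/
def stoppingTime (ω : ℕ → Record) : ℕ∞ :=
  ⨅ (n : ℕ) (_ : ∃ i : Arm, ω n = Sum.inr i), (n : ℕ∞)

/-- The policy stops and recommends arm `i`. -/
def Recommends (ω : ℕ → Record) (i : Arm) : Prop :=
  ∃ n : ℕ, stoppingTime ω = n ∧ ω n = Sum.inr i

/-- The probability that the recommended arm does not have the largest mean, plus `c` times the
expected number of samples; it is `∞` if the latter is. -/
def riskMI (c : ℝ) (π : Policy) (ν : Model) : ℝ≥0∞ :=
  interaction π ν {ω | ∃ i : Arm, Recommends ω i ∧ mean ν i ≠ bestMean ν} +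
    ENNReal.ofReal c * ∫⁻ ω, ((stoppingTime ω : ℕ∞) : ℝ≥0∞) ∂(interaction π ν)

/-- The lower bound as a function of the gap. -/
def hardMI (σ c Δ : ℝ) : ℝ :=
  if √(σ ^ 2 * c) ≤ Δ then
    σ ^ 2 * c / (4 * Δ ^ 2) * Real.log (Real.exp 1 * Δ ^ 2 / (σ ^ 2 * c))
  else 1 / 4

end CostBAI

end

open scoped NNReal

noncomputable section

namespace CostBAI

/-! ### Gaussian models -/

/-! This is a two-point argument. The hard models are Gaussian with variance `σ ^ 2` and means `(Δ,
0)` and `(0, Δ)`; call `P` and `Q` the laws of the records under them. Recommending arm `1` is wrong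
under the first, arm `0` under the second. Either arm separates the two models equally well: each
pull carries divergence `K = Δ ^ 2 / (2 * σ ^ 2)`, so the expected log-likelihood ratio is `K` times
the expected number of pulls, however the policy allocates them.

Since the decision kernels cancel, `Q` has density `exp (-Z)` with respect to `P` on prefixes
(`lintegral_interaction_gaussianModel`), and `E_P[Z] ≤ K * T` with `T = E_P[τ]`
(`centered_interaction`). The two error probabilities add up to at least `E_P[min 1 (exp (-Z))]`, up
to the probability of still sampling, which vanishes when `T` is finite. This yields a
Bretagnolle-Huber bound `exp (-K * T) / 2`, kept as its family of tangent lines in `T`, indexed by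
`s` (`recommendation_error_lower_bound`).

Adding the two risks gives `2 * r ≥ exp (-s) * (1 + s - K * T) / 2 + c * T`; `hardMI_le` chooses `s`
so that the unknown `T` drops out. -/

/-- The bandit model whose arms are Gaussian with means `m` and common variance `v`. -/
def gaussianModel (m : Arm → ℝ) (v : ℝ≥0) : Model := fun a => ⟨gaussianReal (m a) v, inferInstance⟩

theorem mean_gaussianModel (m : Arm → ℝ) (v : ℝ≥0) (a : Arm) : mean (gaussianModel m v) a = m a :=
  integral_id_gaussianReal

theorem hasSubgaussianMGF_gaussianReal (m : ℝ) (v : ℝ≥0) :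
    HasSubgaussianMGF (fun x => x - m) v (gaussianReal m v) := by
  have h (t : ℝ) : (fun x : ℝ => Real.exp (t * (x - m)))
      = fun x => Real.exp (-(t * m)) * Real.exp (t * x) := by
    ext x
    rw [← Real.exp_add]
    congr 1
    ring
  refine ⟨fun t => ?_, fun t => ?_⟩
  · rw [h]
    exact (integrable_exp_mul_gaussianReal t).const_mul _
  · have hm : ∫ x, Real.exp (t * x) ∂(gaussianReal m v) = Real.exp (m * t + v * t ^ 2 / 2) :=
      congrFun (mgf_fun_id_gaussianReal (μ := m) (v := v)) t
    unfold mgf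
    rw [h, integral_const_mul, hm, ← Real.exp_add]
    refine le_of_eq (congrArg _ ?_)
    ring

/-- Chernoff's bound, applied to the exact Gaussian moment generating function. -/
theorem isSubGaussian_gaussianReal {σ : ℝ} (m : ℝ) {v : ℝ≥0} (hv : (v : ℝ) = σ ^ 2) :
    IsSubGaussian σ ⟨gaussianReal m v, inferInstance⟩ := by
  refine ⟨(memLp_id_gaussianReal 1).integrable (by simp), fun t ht => ?_⟩
  simp only [ProbabilityMeasure.coe_mk, integral_id_gaussianReal]
  rw [← hv]
  exact (measureReal_mono fun x (hx : t < x - m) => hx.le).trans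
    ((hasSubgaussianMGF_gaussianReal m v).measure_ge_le ht.le)

theorem gaussianModel_mem_gapClass {σ B Δ : ℝ} {m : Arm → ℝ} {v : ℝ≥0} (hv : (v : ℝ) = σ ^ 2)
    (hm : ∀ a, m a ∈ Set.Icc 0 B) (hΔ : |m 0 - m 1| = Δ) :
    gaussianModel m v ∈ gapClass σ B Δ := by
  refine ⟨fun a => ⟨isSubGaussian_gaussianReal (m a) hv, ?_⟩, ?_⟩
  · rw [mean_gaussianModel]
    exact hm a
  · simpa only [mean_gaussianModel] using hΔ

/-! ### The log-likelihood ratio of two Gaussian models -/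

/-- The log-likelihood ratio of `N(m, v)` with respect to `N(m', v)`. -/
def gaussianLLR (m m' : ℝ) (v : ℝ≥0) (x : ℝ) : ℝ := (m - m') * (2 * x - m - m') / (2 * v)

@[fun_prop]
theorem measurable_gaussianLLR (m m' : ℝ) (v : ℝ≥0) : Measurable (gaussianLLR m m' v) := by
  unfold gaussianLLR
  fun_prop

theorem gaussianReal_eq_withDensity (m m' : ℝ) {v : ℝ≥0} (hv : v ≠ 0) :
    gaussianReal m' v =
      (gaussianReal m v).withDensity fun x => ENNReal.ofReal (Real.exp (-gaussianLLR m m' v x)) := by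
  rw [gaussianReal_of_var_ne_zero m hv, gaussianReal_of_var_ne_zero m' hv,
    ← withDensity_mul _ (measurable_gaussianPDF m v) (by fun_prop)]
  congr 1
  ext x
  have hv' : (v : ℝ) ≠ 0 := NNReal.coe_ne_zero.2 hv
  rw [Pi.mul_apply, gaussianPDF, gaussianPDF, ← ENNReal.ofReal_mul (gaussianPDFReal_nonneg _ _ _),
    gaussianPDFReal, gaussianPDFReal, mul_assoc (√_)⁻¹, ← Real.exp_add]
  congr 3
  unfold gaussianLLR
  field_simp
  ring

theorem integrable_gaussianLLR (m m' : ℝ) (v : ℝ≥0) :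
    Integrable (gaussianLLR m m' v) (gaussianReal m v) := by
  have h : Integrable (fun x : ℝ => x) (gaussianReal m v) :=
    (memLp_id_gaussianReal 1).integrable (by simp)
  unfold gaussianLLR
  exact ((((h.const_mul 2).sub (integrable_const m)).sub (integrable_const m')).const_mul
    (m - m')).div_const _

theorem integral_gaussianLLR (m m' : ℝ) (v : ℝ≥0) :
    ∫ x, gaussianLLR m m' v x ∂(gaussianReal m v) = (m - m') ^ 2 / (2 * v) := by
  have h : Integrable (fun x : ℝ => x) (gaussianReal m v) :=
    (memLp_id_gaussianReal 1).integrable (by simp)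
  unfold gaussianLLR
  have h1 : ∫ x, (2 * x - m - m') ∂(gaussianReal m v) = 2 * m - m - m' := by
    rw [integral_sub (f := fun x => 2 * x - m) ((h.const_mul 2).sub (integrable_const m))
      (integrable_const m'), integral_sub (h.const_mul 2) (integrable_const m), integral_const_mul,
      integral_id_gaussianReal]
    simp
  rw [integral_div, integral_const_mul, h1]
  ring

/-- The log-likelihood ratio of a record, for two Gaussian models. -/
def recordLLR (m m' : Arm → ℝ) (v : ℝ≥0) : Record → ℝ :=
  Sum.elim (fun p => gaussianLLR (m p.1) (m' p.1) v p.2) fun _ => 0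

@[fun_prop]
theorem measurable_recordLLR (m m' : Arm → ℝ) (v : ℝ≥0) : Measurable (recordLLR m m' v) := by
  refine Measurable.sumElim ?_ measurable_const
  exact measurable_from_prod_countable_right fun a => measurable_gaussianLLR (m a) (m' a) v

/-- The density of the second Gaussian model with respect to the first one, on a record. -/
def recordDensity (m m' : Arm → ℝ) (v : ℝ≥0) (r : Record) : ℝ≥0∞ :=
  ENNReal.ofReal (Real.exp (-recordLLR m m' v r))

@[fun_prop]
theorem measurable_recordDensity (m m' : Arm → ℝ) (v : ℝ≥0) : Measurable (recordDensity m m' v) := by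
  unfold recordDensity
  fun_prop

theorem outcome_inl (ν : Model) (a : Arm) :
    outcome ν (Sum.inl a) = (ν a : Measure ℝ).map fun x => Sum.inl (a, x) := rfl

theorem outcome_inr (ν : Model) (i : Arm) :
    outcome ν (Sum.inr i) = Measure.dirac (Sum.inr i) := rfl

theorem measurable_inl_pull (a : Arm) : Measurable fun x : ℝ => (Sum.inl (a, x) : Record) :=
  measurable_inl.comp measurable_prodMk_left

theorem lintegral_outcome_gaussianModel (m m' : Arm → ℝ) {v : ℝ≥0} (hv : v ≠ 0) (d : Decision)
    {G : Record → ℝ≥0∞} (hG : Measurable G) :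
    ∫⁻ r, G r ∂(outcome (gaussianModel m' v) d) =
      ∫⁻ r, G r * recordDensity m m' v r ∂(outcome (gaussianModel m v) d) := by
  rcases d with a | i
  · have hi := measurable_inl_pull a
    rw [outcome_inl, outcome_inl, lintegral_map hG hi, lintegral_map (by fun_prop) hi]
    simp only [gaussianModel, ProbabilityMeasure.coe_mk]
    rw [gaussianReal_eq_withDensity (m a) (m' a) hv,
      lintegral_withDensity_eq_lintegral_mul _ (by fun_prop) (g := fun x => G (Sum.inl (a, x)))
        (hG.comp hi)]
    refine lintegral_congr fun x => ?_
    rw [Pi.mul_apply, mul_comm]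
    rfl
  · rw [outcome_inr, outcome_inr, lintegral_dirac' _ hG, lintegral_dirac' _ (by fun_prop)]
    simp [recordDensity, recordLLR]

theorem step_of_mem_stopped (π : Policy) (ν : Model) (n : ℕ)
    {h : (i : Finset.Iic n) → Record} (hh : h ∈ stopped n) : step π ν n h = Measure.dirac (last n h) := by
  classical
  rw [step, Kernel.piecewise_apply, if_pos hh, Kernel.deterministic_apply]

theorem step_of_notMem_stopped (π : Policy) (ν : Model) (n : ℕ)
    {h : (i : Finset.Iic n) → Record} (hh : h ∉ stopped n) :
    step π ν n h = outcome ν ∘ₘ π.rule (n + 1) (pulls n h) := by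
  classical
  rw [step, Kernel.piecewise_apply, if_neg hh, Kernel.comp_apply, Kernel.comap_apply]

/-- The decision is drawn from the same kernel under both models, so only the reward contributes a
density; after stopping both laws are the same Dirac mass and the density is `1`. -/
theorem lintegral_step_gaussianModel (π : Policy) (m m' : Arm → ℝ) {v : ℝ≥0} (hv : v ≠ 0) (n : ℕ)
    (h : (i : Finset.Iic n) → Record) {G : Record → ℝ≥0∞} (hG : Measurable G) :
    ∫⁻ r, G r ∂(step π (gaussianModel m' v) n h) =
      ∫⁻ r, G r * recordDensity m m' v r ∂(step π (gaussianModel m v) n h) := by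
  by_cases hh : h ∈ stopped n
  · rw [step_of_mem_stopped _ _ _ hh, step_of_mem_stopped _ _ _ hh,
      lintegral_dirac' _ hG, lintegral_dirac' _ (by fun_prop)]
    obtain ⟨i, hi⟩ := hh
    rw [← hi]
    simp [recordDensity, recordLLR]
  · rw [step_of_notMem_stopped _ _ _ hh, step_of_notMem_stopped _ _ _ hh,
      Measure.lintegral_bind (Kernel.aemeasurable _) hG.aemeasurable,
      Measure.lintegral_bind (Kernel.aemeasurable _) (by fun_prop)]
    exact lintegral_congr fun d => lintegral_outcome_gaussianModel m m' hv d hG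

theorem lintegral_firstRecord_gaussianModel (π : Policy) (m m' : Arm → ℝ) {v : ℝ≥0} (hv : v ≠ 0)
    {G : Record → ℝ≥0∞} (hG : Measurable G) :
    ∫⁻ r, G r ∂(firstRecord π (gaussianModel m' v)) =
      ∫⁻ r, G r * recordDensity m m' v r ∂(firstRecord π (gaussianModel m v)) := by
  unfold firstRecord
  rw [Measure.lintegral_bind (Kernel.aemeasurable _) hG.aemeasurable,
      Measure.lintegral_bind (Kernel.aemeasurable _) (by fun_prop)]
  exact lintegral_congr fun d => lintegral_outcome_gaussianModel m m' hv d hG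

/-! ### The law of the records -/

instance (π : Policy) (ν : Model) : IsProbabilityMeasure (firstRecord π ν) := by
  have := π.isMarkov 0
  unfold firstRecord
  infer_instance

theorem lintegral_interaction_succ (π : Policy) (ν : Model) (n : ℕ)
    {F : ((i : Finset.Iic n) → Record) × Record → ℝ≥0∞} (hF : Measurable F) :
    ∫⁻ ω, F (Preorder.frestrictLe n ω, ω (n + 1)) ∂(interaction π ν) =
      ∫⁻ ω, ∫⁻ r, F (Preorder.frestrictLe n ω, r) ∂(step π ν n (Preorder.frestrictLe n ω))
        ∂(interaction π ν) := by
  have h := Kernel.map_frestrictLe_trajMeasure_compProd_eq_map_trajMeasure (X := fun _ => Record)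
    (μ₀ := firstRecord π ν) (κ := step π ν) (a := n)
  rw [interaction, ← lintegral_map (g := fun x : ℕ → Record => (Preorder.frestrictLe n x, x (n + 1))) hF
    (by fun_prop), ← h, Measure.lintegral_compProd hF, lintegral_map _ (by fun_prop)]
  exact hF.lintegral_kernel_prod_right'

theorem map_eval_zero_interaction (π : Policy) (ν : Model) :
    (interaction π ν).map (fun ω => ω 0) = firstRecord π ν := by
  have h : (interaction π ν).map (Preorder.frestrictLe 0) =
      (firstRecord π ν).map (MeasurableEquiv.piUnique fun _ : Finset.Iic 0 => Record).symm := by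
    unfold interaction Kernel.trajMeasure
    rw [Measure.map_comp _ _ (by fun_prop), Kernel.traj_map_frestrictLe, Kernel.partialTraj_self,
      Measure.id_comp]
  have h2 : (fun ω : ℕ → Record => ω 0) = last 0 ∘ Preorder.frestrictLe 0 := rfl
  rw [h2, ← Measure.map_map (measurable_last 0) (by fun_prop), h,
    Measure.map_map (measurable_last 0) (MeasurableEquiv.measurable _)]
  exact Measure.map_id

/-- The prefix of length `n + 2` obtained by appending a record to a prefix of length `n + 1`. -/
def appendRecord (n : ℕ) (p : ((i : Finset.Iic n) → Record) × Record) : (i : Finset.Iic (n + 1)) → Record :=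
  fun i => if hi : (i : ℕ) ≤ n then p.1 ⟨i, Finset.mem_Iic.2 hi⟩ else p.2

theorem measurable_appendRecord (n : ℕ) : Measurable (appendRecord n) := by
  refine measurable_pi_lambda _ fun i => ?_
  unfold appendRecord
  split_ifs
  · exact (measurable_pi_apply _).comp measurable_fst
  · exact measurable_snd

theorem appendRecord_frestrictLe (n : ℕ) (ω : ℕ → Record) :
    appendRecord n (Preorder.frestrictLe n ω, ω (n + 1)) = Preorder.frestrictLe (n + 1) ω := by
  ext1 i
  unfold appendRecord
  split_ifs with hi
  · rfl
  · have : (i : ℕ) = n + 1 := le_antisymm (Finset.mem_Iic.1 i.2) (by omega)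
    exact (congrArg ω this).symm

/-- Change of measure between two Gaussian models, for functions of the first `n + 1` records. -/
theorem lintegral_interaction_gaussianModel (π : Policy) (m m' : Arm → ℝ) {v : ℝ≥0} (hv : v ≠ 0)
    (n : ℕ) {F : ((i : Finset.Iic n) → Record) → ℝ≥0∞} (hF : Measurable F) :
    ∫⁻ ω, F (Preorder.frestrictLe n ω) ∂(interaction π (gaussianModel m' v)) =
      ∫⁻ ω, F (Preorder.frestrictLe n ω) * ∏ i ∈ Finset.range (n + 1), recordDensity m m' v (ω i)
        ∂(interaction π (gaussianModel m v)) := by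
  induction n with
  | zero =>
    let G : Record → ℝ≥0∞ := fun r => F fun _ => r
    have hG : Measurable G := hF.comp (measurable_pi_lambda _ fun _ => measurable_id)
    have hFG (ω : ℕ → Record) : F (Preorder.frestrictLe 0 ω) = G (ω 0) := by
      refine congrArg F (funext fun i => ?_)
      have : (i : ℕ) = 0 := Nat.le_zero.1 (Finset.mem_Iic.1 i.2)
      exact congrArg ω this
    simp only [hFG, zero_add, Finset.prod_range_one]
    rw [← lintegral_map (g := fun ω : ℕ → Record => ω 0) hG (by fun_prop),
      ← lintegral_map (f := fun r => G r * recordDensity m m' v r) (g := fun ω : ℕ → Record => ω 0)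
        (by fun_prop) (by fun_prop), map_eval_zero_interaction, map_eval_zero_interaction]
    exact lintegral_firstRecord_gaussianModel π m m' hv hG
  | succ n ih =>
    have hA := hF.comp (measurable_appendRecord n)
    have hA' (h) : Measurable fun r => F (appendRecord n (h, r)) := hA.comp measurable_prodMk_left
    -- The density of the prefix is known before the new record is drawn, so it factors out of the
    -- integral over that record.
    let D : ((i : Finset.Iic n) → Record) → ℝ≥0∞ := fun h =>
      ∏ i : Finset.Iic n, recordDensity m m' v (h i)
    have hD : Measurable D := Finset.measurable_prod _ fun i _ =>
      (measurable_recordDensity m m' v).comp (measurable_pi_apply i)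
    have hDr (ω : ℕ → Record) : ∏ i ∈ Finset.range (n + 1), recordDensity m m' v (ω i) =
        D (Preorder.frestrictLe n ω) := by
      rw [Nat.range_succ_eq_Iic, ← Finset.prod_coe_sort]
      rfl
    have h1 := lintegral_interaction_succ π (gaussianModel m' v) n hA
    have h2 := lintegral_interaction_succ π (gaussianModel m v) n
      (F := fun p => (F ∘ appendRecord n) p * (D p.1 * recordDensity m m' v p.2)) (hA.mul (by fun_prop))
    simp only [Function.comp_apply, appendRecord_frestrictLe] at h1 h2
    simp only [Finset.prod_range_succ _ (n + 1), hDr]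
    rw [h1, h2]
    have hK : Measurable fun h => ∫⁻ r, F (appendRecord n (h, r)) ∂(step π (gaussianModel m' v) n h) :=
      hA.lintegral_kernel_prod_right'
    rw [ih hK]
    refine lintegral_congr fun ω => ?_
    have hFr : Measurable fun r =>
        F (appendRecord n (Preorder.frestrictLe n ω, r)) * recordDensity m m' v r :=
      (hA' _).mul (measurable_recordDensity m m' v)
    rw [hDr, lintegral_step_gaussianModel π m m' hv n _ (hA' _), ← lintegral_mul_const _ hFr]
    refine lintegral_congr fun r => ?_
    ring

/-! ### Expected log-likelihood ratio -/

/-- The function `g` has absolute moment at most `C` and mean zero under `μ`. -/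
def Centered {α : Type*} [MeasurableSpace α] (g : α → ℝ) (C : ℝ≥0∞) (μ : Measure α) : Prop :=
  ∫⁻ x, ‖g x‖ₑ ∂μ ≤ C ∧ ∫ x, g x ∂μ = 0

theorem Centered.integrable {α : Type*} [MeasurableSpace α] {g : α → ℝ} {C : ℝ≥0∞} {μ : Measure α}
    (h : Centered g C μ) (hg : Measurable g) (hC : C ≠ ∞) : Integrable g μ :=
  ⟨hg.aestronglyMeasurable, h.1.trans_lt hC.lt_top⟩

/-- The moment bound is uniform over the fibres, so it passes to the mixture; this gives the
integrability needed to integrate fibrewise. -/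
theorem Centered.comp {α β : Type*} [MeasurableSpace α] [MeasurableSpace β] {μ : Measure α}
    [IsProbabilityMeasure μ] {κ : Kernel α β} [IsMarkovKernel κ] {g : β → ℝ} {C : ℝ≥0∞}
    (hg : Measurable g) (hC : C ≠ ∞) (h : ∀ a, Centered g C (κ a)) : Centered g C (κ ∘ₘ μ) := by
  have h1 : ∫⁻ x, ‖g x‖ₑ ∂(κ ∘ₘ μ) ≤ C := by
    rw [Measure.lintegral_bind (Kernel.aemeasurable _) (by fun_prop)]
    calc ∫⁻ a, ∫⁻ x, ‖g x‖ₑ ∂(κ a) ∂μ ≤ ∫⁻ _, C ∂μ := lintegral_mono fun a => (h a).1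
      _ = C := by simp
  refine ⟨h1, ?_⟩
  have hi : Integrable g (κ ∘ₘ μ) := ⟨hg.aestronglyMeasurable, h1.trans_lt hC.lt_top⟩
  rw [Measure.comp_eq_comp_const_apply] at hi ⊢
  rw [Kernel.integral_comp hi]
  simp [(h _).2]

theorem centered_dirac {α : Type*} [MeasurableSpace α] {g : α → ℝ} {C : ℝ≥0∞} (hg : Measurable g)
    {x : α} (hx : g x = 0) : Centered g C (Measure.dirac x) := by
  refine ⟨?_, ?_⟩
  · rw [lintegral_dirac' _ (by fun_prop), hx]
    simp
  · rw [integral_dirac' _ _ hg.stronglyMeasurable, hx]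

/-- The indicator of the pull records. -/
def pullInd : Record → ℝ := Sum.elim (fun _ => 1) fun _ => 0

@[fun_prop]
theorem measurable_pullInd : Measurable pullInd := measurable_const.sumElim measurable_const

theorem pullInd_nonneg (r : Record) : 0 ≤ pullInd r := by
  rcases r with p | i <;> simp [pullInd]

theorem pullInd_le_one (r : Record) : pullInd r ≤ 1 := by
  rcases r with p | i <;> simp [pullInd]

theorem integrable_pullInd (π : Policy) (ν : Model) (n : ℕ) :
    Integrable (fun ω => pullInd (ω n)) (interaction π ν) :=
  Integrable.of_bound (C := 1)
    (measurable_pullInd.comp (measurable_pi_apply n)).aestronglyMeasurable (Filter.Eventually.of_forall fun ω => by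
    rw [Real.norm_eq_abs, abs_of_nonneg (pullInd_nonneg _)]
    exact pullInd_le_one _)

/-- As both arms have the same divergence `K`, subtracting `K` per pull centres the log-likelihood
ratio whatever the decision. Summing the moments over the two arms makes `C` independent of the
decision. -/
theorem centered_outcome (m m' : Arm → ℝ) (v : ℝ≥0) {K : ℝ}
    (hK : ∀ a, (m a - m' a) ^ 2 / (2 * v) = K) :
    ∃ C : ℝ≥0∞, C ≠ ∞ ∧ ∀ d, Centered (fun r => recordLLR m m' v r - K * pullInd r) C
      (outcome (gaussianModel m v) d) := by
  have hi (a : Arm) : Integrable (fun x => gaussianLLR (m a) (m' a) v x - K) (gaussianReal (m a) v) :=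
    (integrable_gaussianLLR _ _ _).sub (integrable_const K)
  have hg : Measurable fun r => recordLLR m m' v r - K * pullInd r := by fun_prop
  refine ⟨∑ a, ∫⁻ x, ‖gaussianLLR (m a) (m' a) v x - K‖ₑ ∂(gaussianReal (m a) v),
    ENNReal.sum_ne_top.2 fun a _ => (hi a).2.ne, fun d => ?_⟩
  rcases d with a | i
  · rw [outcome_inl]
    have hm := measurable_inl_pull a
    refine ⟨?_, ?_⟩
    · rw [lintegral_map (by fun_prop) hm]
      simp only [recordLLR, pullInd, Sum.elim_inl, mul_one, gaussianModel, ProbabilityMeasure.coe_mk]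
      exact Finset.single_le_sum
        (f := fun a => ∫⁻ x, ‖gaussianLLR (m a) (m' a) v x - K‖ₑ ∂(gaussianReal (m a) v))
        (fun _ _ => zero_le) (Finset.mem_univ a)
    · rw [integral_map hm.aemeasurable hg.aestronglyMeasurable]
      simp only [recordLLR, pullInd, Sum.elim_inl, mul_one, gaussianModel, ProbabilityMeasure.coe_mk]
      rw [integral_sub (integrable_gaussianLLR _ _ _) (integrable_const K), integral_gaussianLLR, hK]
      simp
  · rw [outcome_inr]
    exact centered_dirac hg (by simp [recordLLR, pullInd])

theorem map_eval_succ_interaction (π : Policy) (ν : Model) (n : ℕ) :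
    (interaction π ν).map (fun ω => ω (n + 1)) =
      step π ν n ∘ₘ (interaction π ν).map (Preorder.frestrictLe n) := by
  have h := Kernel.map_frestrictLe_trajMeasure_compProd_eq_map_trajMeasure (X := fun _ => Record)
    (μ₀ := firstRecord π ν) (κ := step π ν) (a := n)
  rw [← Measure.snd_compProd, interaction, h, Measure.snd, Measure.map_map measurable_snd (by fun_prop)]
  rfl

/-- A Wald identity round by round: the law of a record is a mixture of outcome laws and of Dirac
masses at stop records, all of them centred. -/
theorem centered_interaction (π : Policy) (m m' : Arm → ℝ) (v : ℝ≥0) {K : ℝ}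
    (hK : ∀ a, (m a - m' a) ^ 2 / (2 * v) = K) (n : ℕ) :
    Integrable (fun ω => recordLLR m m' v (ω n)) (interaction π (gaussianModel m v)) ∧
    ∫ ω, recordLLR m m' v (ω n) ∂(interaction π (gaussianModel m v)) =
      K * ∫ ω, pullInd (ω n) ∂(interaction π (gaussianModel m v)) := by
  obtain ⟨C, hC, ho⟩ := centered_outcome m m' v hK
  have hg : Measurable fun r => recordLLR m m' v r - K * pullInd r := by fun_prop
  have hlaw : Centered (fun r => recordLLR m m' v r - K * pullInd r) C
      ((interaction π (gaussianModel m v)).map fun ω => ω n) := by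
    cases n with
    | zero =>
      rw [map_eval_zero_interaction]
      have := π.isMarkov 0
      exact Centered.comp hg hC ho
    | succ n =>
      rw [map_eval_succ_interaction]
      have : IsProbabilityMeasure ((interaction π (gaussianModel m v)).map (Preorder.frestrictLe n)) :=
        Measure.isProbabilityMeasure_map (by fun_prop)
      refine Centered.comp hg hC fun h => ?_
      by_cases hh : h ∈ stopped n
      · rw [step_of_mem_stopped _ _ _ hh]
        obtain ⟨i, hi⟩ := hh
        exact centered_dirac hg (by rw [← hi]; simp [recordLLR, pullInd])
      · rw [step_of_notMem_stopped _ _ _ hh]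
        have := π.isMarkov (n + 1)
        exact Centered.comp hg hC ho
  have hi := (hlaw.integrable hg hC).comp_measurable (measurable_pi_apply n)
  have h0 := hlaw.2
  rw [integral_map (measurable_pi_apply n).aemeasurable hg.aestronglyMeasurable] at h0
  have hp := (integrable_pullInd π (gaussianModel m v) n).const_mul K
  have hz : Integrable (fun ω => recordLLR m m' v (ω n)) (interaction π (gaussianModel m v)) := by
    refine (hi.add hp).congr (Filter.Eventually.of_forall fun ω => ?_)
    simp
  refine ⟨hz, ?_⟩
  rw [integral_sub hz hp, integral_const_mul] at h0
  linarith

/-! ### Stopping -/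

theorem measurableSet_singleton_inr (i : Arm) : MeasurableSet {(Sum.inr i : Record)} := by
  rw [← Set.image_singleton]
  exact (measurableSet_singleton i).inr_image

/-- Conditionally on the prefix, leaving a stop record has probability zero, since the step there is
a Dirac mass. -/
theorem ae_absorbing (π : Policy) (ν : Model) :
    ∀ᵐ ω ∂(interaction π ν), ∀ (n : ℕ) (i : Arm), ω n = Sum.inr i → ω (n + 1) = Sum.inr i := by
  refine ae_all_iff.2 fun n => ae_all_iff.2 fun i => ?_
  have hs := measurableSet_singleton_inr i
  let S : Set (((i : Finset.Iic n) → Record) × Record) :=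
    {p | last n p.1 = Sum.inr i ∧ ¬ p.2 = Sum.inr i}
  have hS : MeasurableSet S :=
    (((measurable_last n).comp measurable_fst) hs).inter (measurable_snd hs.compl)
  have hF : Measurable (S.indicator fun _ => (1 : ℝ≥0∞)) := measurable_const.indicator hS
  have h := lintegral_interaction_succ π ν n hF
  have h0 (ω : ℕ → Record) : ∫⁻ r, S.indicator (fun _ => (1 : ℝ≥0∞)) (Preorder.frestrictLe n ω, r)
      ∂(step π ν n (Preorder.frestrictLe n ω)) = 0 := by
    by_cases hω : last n (Preorder.frestrictLe n ω) = Sum.inr i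
    · rw [step_of_mem_stopped _ _ _ ⟨i, hω.symm⟩, lintegral_dirac' (f := fun r =>
        S.indicator (fun _ => (1 : ℝ≥0∞)) (Preorder.frestrictLe n ω, r)) _ (hF.comp measurable_prodMk_left)]
      simp [S, hω]
    · simp [S, hω]
  simp only [h0, lintegral_zero] at h
  rw [lintegral_eq_zero_iff (f := fun ω : ℕ → Record =>
    S.indicator (fun _ => (1 : ℝ≥0∞)) (Preorder.frestrictLe n ω, ω (n + 1))) (hF.comp (by fun_prop))] at h
  filter_upwards [h] with ω hω hn
  by_contra hc
  have hmem : (Preorder.frestrictLe n ω, ω (n + 1)) ∈ S := ⟨hn, hc⟩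
  simp [hmem] at hω

theorem eq_inr_of_le {ω : ℕ → Record}
    (hω : ∀ (n : ℕ) (i : Arm), ω n = Sum.inr i → ω (n + 1) = Sum.inr i) {k n : ℕ} (hkn : k ≤ n)
    {i : Arm} (hi : ω k = Sum.inr i) : ω n = Sum.inr i := by
  induction n, hkn using Nat.le_induction with
  | base => exact hi
  | succ n _ ih => exact hω n i ih

theorem recommends_of_eq_inr {ω : ℕ → Record}
    (hω : ∀ (n : ℕ) (i : Arm), ω n = Sum.inr i → ω (n + 1) = Sum.inr i) {n : ℕ} {i : Arm}
    (hi : ω n = Sum.inr i) : Recommends ω i := by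
  classical
  have hex : ∃ n, ∃ i : Arm, ω n = Sum.inr i := ⟨n, i, hi⟩
  obtain ⟨j, hj⟩ := Nat.find_spec hex
  refine ⟨Nat.find hex, le_antisymm (iInf₂_le _ ⟨j, hj⟩) (le_iInf₂ fun k hk => ?_), ?_⟩
  · exact_mod_cast Nat.find_min' hex hk
  · have h := eq_inr_of_le hω (Nat.find_min' hex ⟨i, hi⟩) hj
    rw [hj, ← h, hi]

theorem sum_pullInd_le_stoppingTime {ω : ℕ → Record}
    (hω : ∀ (n : ℕ) (i : Arm), ω n = Sum.inr i → ω (n + 1) = Sum.inr i) (n : ℕ) :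
    ENNReal.ofReal (∑ i ∈ Finset.range n, pullInd (ω i)) ≤ ((stoppingTime ω : ℕ∞) : ℝ≥0∞) := by
  have key (k : ℕ) (hk : ∃ i : Arm, ω k = Sum.inr i) : ∑ i ∈ Finset.range n, pullInd (ω i) ≤ k := by
    obtain ⟨j, hj⟩ := hk
    calc ∑ i ∈ Finset.range n, pullInd (ω i)
        ≤ ∑ i ∈ Finset.range n, if i < k then (1 : ℝ) else 0 := by
          refine Finset.sum_le_sum fun i _ => ?_
          split_ifs with hik
          · exact pullInd_le_one _
          · rw [eq_inr_of_le hω (not_lt.1 hik) hj]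
            simp [pullInd]
      _ = ((Finset.range n).filter (· < k)).card := by rw [Finset.sum_boole]
      _ ≤ k := by
          have : (Finset.range n).filter (· < k) ⊆ Finset.range k := fun i hi => by
            simpa using (Finset.mem_filter.1 hi).2
          simpa using Finset.card_le_card this
  by_cases hex : ∃ k, ∃ i : Arm, ω k = Sum.inr i
  · obtain ⟨k, i, hk⟩ := hex
    obtain ⟨l, hl, hl'⟩ := recommends_of_eq_inr hω hk
    rw [hl]
    exact ENNReal.ofReal_le_of_le_toReal (by simpa using key l ⟨i, hl'⟩)
  · have : stoppingTime ω = ⊤ := by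
      simp only [stoppingTime, iInf_eq_top]
      exact fun k hk => absurd ⟨k, hk⟩ hex
    simp [this]

/-! ### Lower bound on the sum of the two error probabilities -/

/-- The indicator of the stop record with recommendation `i`. -/
def stopInd (i : Arm) : Record → ℝ := ({Sum.inr i} : Set Record).indicator fun _ => 1

@[fun_prop]
theorem measurable_stopInd (i : Arm) : Measurable (stopInd i) :=
  measurable_const.indicator (measurableSet_singleton_inr i)

theorem stopInd_nonneg (i : Arm) (r : Record) : 0 ≤ stopInd i r :=
  Set.indicator_nonneg (fun _ _ => zero_le_one) r

theorem stopInd_le_one (i : Arm) (r : Record) : stopInd i r ≤ 1 :=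
  Set.indicator_le_self' (fun _ _ => zero_le_one) r

/-- Reading the recommendation at a fixed round gives a function of a finite prefix, to which the
change of measure applies. By absorption this only undercounts the recommendation event. -/
theorem integral_stopInd (π : Policy) (ν : Model) (n : ℕ) (i : Arm) :
    Integrable (fun ω => stopInd i (ω n)) (interaction π ν) ∧
    ∫ ω, stopInd i (ω n) ∂(interaction π ν) ≤ (interaction π ν).real {ω | Recommends ω i} := by
  have hm : MeasurableSet {ω : ℕ → Record | ω n = Sum.inr i} :=
    (measurable_pi_apply n : Measurable fun ω : ℕ → Record => ω n) (measurableSet_singleton_inr i)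
  have he : (fun ω : ℕ → Record => stopInd i (ω n)) = Set.indicator {ω | ω n = Sum.inr i} 1 := rfl
  rw [he]
  refine ⟨(integrable_const 1).indicator hm, ?_⟩
  rw [integral_indicator_one hm]
  refine ENNReal.toReal_mono (measure_ne_top _ _) (measure_mono_ae ?_)
  filter_upwards [ae_absorbing π ν] with ω hω hi
  exact recommends_of_eq_inr hω hi

/-- Pointwise linear minorant of `min 1 (exp (-z))`. -/
theorem linear_minorant_min_exp (s z : ℝ) :
    Real.exp (-s) * (1 + s / 2 - z / 2) - Real.exp (-s) * (1 + Real.exp (-z)) / 4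
      ≤ min 1 (Real.exp (-z)) := by
  obtain ⟨a, ha⟩ : ∃ a, a = Real.exp (-s / 2) := ⟨_, rfl⟩
  obtain ⟨u, hu⟩ : ∃ u, u = Real.exp (-z / 2) := ⟨_, rfl⟩
  have ha2 : Real.exp (-s) = a * a := by rw [ha, ← Real.exp_add]; ring_nf
  have hu2 : Real.exp (-z) = u * u := by rw [hu, ← Real.exp_add]; ring_nf
  have ha0 : 0 < a := ha ▸ Real.exp_pos _
  -- The tangent line of `exp (-z / 2)` at `z = s`.
  have h1 : a * (1 + s / 2 - z / 2) ≤ u := by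
    have h := Real.add_one_le_exp (s / 2 - z / 2)
    have hau : u = a * Real.exp (s / 2 - z / 2) := by rw [ha, hu, ← Real.exp_add]; ring_nf
    rw [hau]
    exact mul_le_mul_of_nonneg_left (by linarith) ha0.le
  have h2 := mul_le_mul_of_nonneg_left h1 ha0.le
  rw [ha2, hu2]
  -- It remains to bound `a * u`, by AM-GM: `a * u ≤ 1 + (a * u) ^ 2 / 4` and `a * u ≤ u ^ 2 + a ^ 2
  -- / 4`.
  refine le_min ?_ ?_
  · nlinarith [sq_nonneg (1 - a * u / 2), sq_nonneg a]
  · nlinarith [sq_nonneg (u - a / 2), sq_nonneg (a * u)]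

/-- If the means of the arms of two Gaussian models differ by the same amount, then no policy has a
small probability of recommending arm `1` under the first one and arm `0` under the second one,
unless its expected number of samples under the first one is large. -/
theorem recommendation_error_lower_bound (π : Policy) (m m' : Arm → ℝ) {v : ℝ≥0} (hv : v ≠ 0)
    {K : ℝ} (hK : ∀ a, (m a - m' a) ^ 2 / (2 * v) = K) (s : ℝ)
    (hT : ∫⁻ ω, ((stoppingTime ω : ℕ∞) : ℝ≥0∞) ∂(interaction π (gaussianModel m v)) ≠ ∞) :
    Real.exp (-s) * (1 + s - K *
        (∫⁻ ω, ((stoppingTime ω : ℕ∞) : ℝ≥0∞) ∂(interaction π (gaussianModel m v))).toReal) / 2 ≤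
      (interaction π (gaussianModel m v)).real {ω | Recommends ω 1} +
        (interaction π (gaussianModel m' v)).real {ω | Recommends ω 0} := by
  set P := interaction π (gaussianModel m v)
  set Q := interaction π (gaussianModel m' v)
  set T := (∫⁻ ω, ((stoppingTime ω : ℕ∞) : ℝ≥0∞) ∂P).toReal
  have hK0 : 0 ≤ K := by rw [← hK 0]; positivity
  have hsum (n : ℕ) : ∑ i ∈ Finset.range n, ∫ ω, pullInd (ω i) ∂P ≤ T := by
    rw [← integral_finsetSum _ fun i _ => integrable_pullInd π _ i]
    refine (ENNReal.ofReal_le_iff_le_toReal hT).1 ?_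
    rw [ofReal_integral_eq_lintegral_ofReal
      (integrable_finsetSum _ fun i _ => integrable_pullInd π _ i)
      (Filter.Eventually.of_forall fun ω => Finset.sum_nonneg fun i _ => pullInd_nonneg _)]
    refine lintegral_mono_ae ?_
    filter_upwards [ae_absorbing π (gaussianModel m v)] with ω hω
    exact sum_pullInd_le_stoppingTime hω n
  -- The probabilities of pulling in round `n` sum to at most `T`, hence tend to zero.
  have hlim : Filter.Tendsto (fun n => ∫ ω, pullInd (ω n) ∂P) Filter.atTop (nhds 0) :=
    (summable_of_sum_range_le (fun n => integral_nonneg fun ω => pullInd_nonneg _)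
      hsum).tendsto_atTop_zero
  have hbound (n : ℕ) : Real.exp (-s) * (1 + s - K * T) / 2 - ∫ ω, pullInd (ω n) ∂P ≤
      P.real {ω | Recommends ω 1} + Q.real {ω | Recommends ω 0} := by
    let Z : (ℕ → Record) → ℝ := fun ω => ∑ i ∈ Finset.range (n + 1), recordLLR m m' v (ω i)
    have hZm : Measurable Z := by fun_prop
    have hdens (ω : ℕ → Record) : ∏ i ∈ Finset.range (n + 1), recordDensity m m' v (ω i) =
        ENNReal.ofReal (Real.exp (-Z ω)) := by
      unfold recordDensity
      rw [← ENNReal.ofReal_prod_of_nonneg fun i _ => (Real.exp_pos _).le, ← Real.exp_sum,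
        Finset.sum_neg_distrib]
    have hexp : ∫⁻ ω, ENNReal.ofReal (Real.exp (-Z ω)) ∂P = 1 := by
      have h := lintegral_interaction_gaussianModel π m m' hv n (F := fun _ => 1) measurable_const
      simp only [hdens, one_mul] at h
      rw [← h]
      simp
    have hexpi : Integrable (fun ω => Real.exp (-Z ω)) P := by
      refine (lintegral_ofReal_ne_top_iff_integrable (by fun_prop)
        (Filter.Eventually.of_forall fun ω => (Real.exp_pos _).le)).1 ?_
      rw [hexp]
      exact ENNReal.one_ne_top
    have hexp1 : ∫ ω, Real.exp (-Z ω) ∂P = 1 := by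
      rw [integral_eq_lintegral_of_nonneg_ae
        (Filter.Eventually.of_forall fun ω => (Real.exp_pos _).le) (by fun_prop), hexp]
      simp
    have hZi : Integrable Z P :=
      integrable_finsetSum _ fun i _ => (centered_interaction π m m' v hK i).1
    have hZ : ∫ ω, Z ω ∂P ≤ K * T := by
      rw [integral_finsetSum _ fun i _ => (centered_interaction π m m' v hK i).1,
        Finset.sum_congr rfl fun i _ => (centered_interaction π m m' v hK i).2, ← Finset.mul_sum]
      exact mul_le_mul_of_nonneg_left (hsum _) hK0
    have hBi : Integrable (fun ω => stopInd 0 (ω n) * Real.exp (-Z ω)) P := by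
      refine hexpi.mono (by fun_prop) (Filter.Eventually.of_forall fun ω => ?_)
      rw [norm_mul, Real.norm_of_nonneg (stopInd_nonneg _ _)]
      exact mul_le_of_le_one_left (norm_nonneg _) (stopInd_le_one _ _)
    have hB : ∫ ω, stopInd 0 (ω n) * Real.exp (-Z ω) ∂P ≤ Q.real {ω | Recommends ω 0} := by
      refine le_trans (le_of_eq ?_) (integral_stopInd π (gaussianModel m' v) n 0).2
      rw [integral_eq_lintegral_of_nonneg_ae (Filter.Eventually.of_forall fun ω =>
          mul_nonneg (stopInd_nonneg _ _) (Real.exp_pos _).le) (by fun_prop),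
        integral_eq_lintegral_of_nonneg_ae (Filter.Eventually.of_forall fun ω => stopInd_nonneg _ _)
          (integral_stopInd π (gaussianModel m' v) n 0).1.aestronglyMeasurable]
      have h := lintegral_interaction_gaussianModel π m m' hv n
        (F := fun h => ENNReal.ofReal (stopInd 0 (last n h)))
        (((measurable_stopInd 0).comp (measurable_last n)).ennreal_ofReal)
      simp only [hdens, ← ENNReal.ofReal_mul (stopInd_nonneg _ _)] at h
      exact congrArg _ h.symm
    have hA := integral_stopInd π (gaussianModel m v) n 1
    have hI := integrable_pullInd π (gaussianModel m v) n
    -- Round `n` either stops with `1`, stops with `0` or pulls; the matching term on the right is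
    -- `1`, `exp (-Z ω)` or `1`, at least the minimum in each case.
    have hpt (ω : ℕ → Record) :
        Real.exp (-s) * (1 + s / 2 - Z ω / 2) - Real.exp (-s) * (1 + Real.exp (-Z ω)) / 4 ≤
          stopInd 1 (ω n) + stopInd 0 (ω n) * Real.exp (-Z ω) + pullInd (ω n) := by
      refine (linear_minorant_min_exp s (Z ω)).trans ?_
      have hpos := Real.exp_pos (-Z ω)
      rcases h : ω n with p | i
      · simp [stopInd, pullInd]
      · fin_cases i <;> simp [stopInd, pullInd]
    have hi1 : Integrable (fun ω => Real.exp (-s) * (1 + s / 2 - Z ω / 2)) P :=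
      ((integrable_const _).sub (hZi.div_const 2)).const_mul _
    have hi2 : Integrable (fun ω => Real.exp (-s) * (1 + Real.exp (-Z ω)) / 4) P :=
      (((integrable_const _).add hexpi).const_mul _).div_const 4
    have hi3 : Integrable (fun ω => stopInd 1 (ω n) + stopInd 0 (ω n) * Real.exp (-Z ω)) P :=
      hA.1.add hBi
    -- Since `exp (-Z)` has mean `1`, the correction integrates to `exp (-s) / 2`, leaving `exp (-s)
    -- * (1 + s - E_P[Z]) / 2`.
    have hle : _ ≤ _ := integral_mono (μ := P) (hi1.sub hi2) (hi3.add hI) hpt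
    simp only [Pi.sub_apply, Pi.add_apply] at hle
    rw [integral_sub hi1 hi2, integral_add hi3 hI, integral_add hA.1 hBi, integral_const_mul,
      integral_sub (integrable_const _) (hZi.div_const 2), integral_div, integral_div,
      integral_const_mul, integral_add (integrable_const _) hexpi, hexp1] at hle
    simp only [integral_const, probReal_univ, smul_eq_mul, one_mul] at hle
    have hZ' := mul_le_mul_of_nonneg_left hZ (Real.exp_pos (-s)).le
    linarith [hA.2]
  have hl := (hlim.const_sub (Real.exp (-s) * (1 + s - K * T) / 2))
  rw [sub_zero] at hl
  exact le_of_tendsto' hl hbound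

/-! ### Optimisation of the bound -/

/-- With `x = Δ ^ 2 / (σ ^ 2 * c)` and `L = c * T`, summing the hypotheses gives `2 * r ≥ exp (-s) *
(1 + s - x * L / 2) / 2 + L`, where `L` has coefficient `1 - exp (-s) * x / 4`. The threshold is
thus `x = 4`, not the `x = 1` of the statement. -/
theorem hardMI_le {σ c Δ : ℝ} (hσ : 0 < σ) (hc : 0 < c) (hΔ : 0 < Δ) {p q T r : ℝ}
    (hT : 0 ≤ T) (hp : p + c * T ≤ r) (hq : q ≤ r)
    (h : ∀ s : ℝ, Real.exp (-s) * (1 + s - Δ ^ 2 / (2 * σ ^ 2) * T) / 2 ≤ p + q) :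
    hardMI σ c Δ ≤ r := by
  obtain ⟨x, hx⟩ : ∃ x, x = Δ ^ 2 / (σ ^ 2 * c) := ⟨_, rfl⟩
  have hx0 : 0 < x := by rw [hx]; positivity
  obtain ⟨L, hL⟩ : ∃ L, L = c * T := ⟨_, rfl⟩
  have hL0 : 0 ≤ L := by rw [hL]; positivity
  have hKT : Δ ^ 2 / (2 * σ ^ 2) * T = x * L / 2 := by
    rw [hx, hL]
    field_simp
  rw [hKT] at h
  -- At `s = 0` the coefficient of `L` is nonnegative, so `L` can be discarded.
  have hquarter (hx4 : x ≤ 4) : 1 / 4 ≤ r := by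
    have h0 := h 0
    simp only [neg_zero, Real.exp_zero] at h0
    nlinarith
  have hval : σ ^ 2 * c / (4 * Δ ^ 2) * Real.log (Real.exp 1 * Δ ^ 2 / (σ ^ 2 * c)) =
      (1 + Real.log x) / (4 * x) := by
    rw [mul_div_assoc (Real.exp 1), ← hx, Real.log_mul (Real.exp_pos 1).ne' hx0.ne', Real.log_exp, hx]
    field_simp
  unfold hardMI
  split_ifs with hcase
  · rw [hval]
    rcases le_or_gt x 4 with hx4 | hx4
    · refine le_trans ?_ (hquarter hx4)
      rw [div_le_div_iff₀ (by positivity) (by norm_num)]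
      linarith [Real.log_le_sub_one_of_pos hx0]
    -- This `s` makes the coefficient of `L` vanish exactly.
    · have hs := h (Real.log (x / 4))
      have h4 : Real.log 4 = 2 * Real.log 2 := by
        rw [← Real.log_rpow (by norm_num)]
        norm_num
      have hlogx : Real.log 4 ≤ Real.log x := Real.log_le_log (by norm_num) hx4.le
      rw [Real.exp_neg, Real.exp_log (by positivity), Real.log_div hx0.ne' (by norm_num), h4] at hs
      have hs' : (x / 4)⁻¹ * (1 + (Real.log x - 2 * Real.log 2) - x * L / 2) / 2 =
          2 * (1 + (Real.log x - 2 * Real.log 2)) / x - L := by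
        field_simp
        ring
      rw [hs'] at hs
      -- The claim amounts to `8 * log 2 ≤ 3 + 3 * log x`, which follows from `log x ≥ 2 * log 2`
      -- and `2 * log 2 ≤ 3`.
      have hcmp : (1 + Real.log x) / (4 * x) ≤ (1 + (Real.log x - 2 * Real.log 2)) / x := by
        rw [div_le_div_iff₀ (by positivity) hx0]
        have := Real.log_two_lt_d9
        have : 1 + Real.log x ≤ 4 * (1 + (Real.log x - 2 * Real.log 2)) := by linarith
        nlinarith
      have h2 : 2 * (1 + (Real.log x - 2 * Real.log 2)) / x =
          2 * ((1 + (Real.log x - 2 * Real.log 2)) / x) := by ring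
      linarith
  · refine hquarter ?_
    have hΔ2 := (Real.lt_sqrt hΔ.le).1 (not_le.1 hcase)
    rw [hx, div_le_iff₀ (by positivity)]
    nlinarith [sq_nonneg Δ]

theorem measureReal_recommends_add_le {c : ℝ} (hc : 0 < c) {π : Policy} {ν : Model} {i : Arm}
    (hi : mean ν i ≠ bestMean ν) {R : ℝ≥0∞} (hR : R ≠ ∞) (h : riskMI c π ν ≤ R) :
    ∫⁻ ω, ((stoppingTime ω : ℕ∞) : ℝ≥0∞) ∂(interaction π ν) ≠ ∞ ∧
    (interaction π ν).real {ω | Recommends ω i} +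
      c * (∫⁻ ω, ((stoppingTime ω : ℕ∞) : ℝ≥0∞) ∂(interaction π ν)).toReal ≤ R.toReal := by
  have hne : ENNReal.ofReal c * ∫⁻ ω, ((stoppingTime ω : ℕ∞) : ℝ≥0∞) ∂(interaction π ν) ≠ ∞ :=
    ne_top_of_le_ne_top hR (le_add_self.trans h)
  refine ⟨fun ht => hne ?_, ?_⟩
  · rw [ht]
    exact ENNReal.mul_top (ENNReal.ofReal_pos.2 hc).ne'
  · refine le_trans ?_ (ENNReal.toReal_mono hR h)
    rw [riskMI, ENNReal.toReal_add (measure_ne_top _ _) hne, ENNReal.toReal_mul,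
      ENNReal.toReal_ofReal hc.le]
    gcongr
    exact ENNReal.toReal_mono (measure_ne_top _ _) (measure_mono fun ω hω => ⟨i, hω, hi⟩)

end CostBAI

end

theorem corollary1 (σ B c Δ : ℝ) (hσ : 0 < σ) (hc : 0 < c) (hΔ : 0 < Δ) (hΔB : Δ ≤ B)
    (π : CostBAI.Policy) :
    ENNReal.ofReal (CostBAI.hardMI σ c Δ) ≤
      ⨆ ν ∈ CostBAI.gapClass σ B Δ, CostBAI.riskMI c π ν := by
  open CostBAI in
  set R := ⨆ ν ∈ gapClass σ B Δ, riskMI c π ν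
  by_cases hR : R = ∞
  · rw [hR]
    exact le_top
  have hB : 0 ≤ B := hΔ.le.trans hΔB
  let v : ℝ≥0 := ⟨σ ^ 2, sq_nonneg σ⟩
  have hvσ : (v : ℝ) = σ ^ 2 := rfl
  have hv : v ≠ 0 := fun h => (pow_pos hσ 2).ne' (congrArg NNReal.toReal h)
  -- Swapping the arms moves each mean by `Δ`, so both have the same divergence; `Δ ≤ B` keeps the
  -- means in range.
  let m : Arm → ℝ := ![Δ, 0]
  let m' : Arm → ℝ := ![0, Δ]
  have hmem : gaussianModel m v ∈ gapClass σ B Δ :=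
    gaussianModel_mem_gapClass hvσ (fun a => by fin_cases a <;> simp [m, hΔ.le, hΔB, hB])
      (by simp [m, abs_of_pos hΔ])
  have hmem' : gaussianModel m' v ∈ gapClass σ B Δ :=
    gaussianModel_mem_gapClass hvσ (fun a => by fin_cases a <;> simp [m', hΔ.le, hΔB, hB])
      (by simp [m', abs_of_pos hΔ])
  have h1 := measureReal_recommends_add_le hc (i := 1)
    (by simp [bestMean, mean_gaussianModel, m, hΔ.le, hΔ.ne]) hR
    (le_iSup₂ (f := fun ν (_ : ν ∈ gapClass σ B Δ) => riskMI c π ν) _ hmem)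
  have h0 := measureReal_recommends_add_le hc (i := 0)
    (by simp [bestMean, mean_gaussianModel, m', hΔ.le, hΔ.ne]) hR
    (le_iSup₂ (f := fun ν (_ : ν ∈ gapClass σ B Δ) => riskMI c π ν) _ hmem')
  refine (ENNReal.ofReal_le_iff_le_toReal hR).2
    (hardMI_le hσ hc hΔ ENNReal.toReal_nonneg h1.2 (le_trans ?_ h0.2) fun s =>
      recommendation_error_lower_bound π m m' hv (fun a => ?_) s h1.1)
  -- The sampling cost under the second model is dropped.
  · exact le_add_of_nonneg_right (mul_nonneg hc.le ENNReal.toReal_nonneg)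
  · rw [hvσ]
    fin_cases a <;> simp [m, m']
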